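/- Let $G$ be an archimedean (hence abelian) lattice-ordered group, written additively, and let $u\in G$, $u\ge 0$, be a weak order unit. For $S\subseteq G$ put $S^\perp=\{h\in G:|h|\wedge|g|=0\text{ for all }g\in S\}$ and write $g^\perp=\{g\}^\perp$, $g^{\perp\perp}=(g^\perp)^\perp$; an element $g$ is a weak order unit if $g^\perp=\{0\}$. Let $YG$ be the set of values of $u$, i.e. of convex $\ell$-subgroups of $G$ maximal with respect to not containing $u$, with the hull-kernel topology generated by the sets $\{V\in YG:g\notin V\}$, $g\in G$, and put $Z(g)=\{V\in YG:g\in V\}$. A $d$-subgroup is a convex $\ell$-subgroup $H$ with $h^{\perp\perp}\subseteq H$ for all $h\in H$. Let $\mathrm{Max}_d(G)$ be the set of maximal proper $d$-subgroups, with the hull-kernel topology generated by the sets $\{M\in \mathrm{Max}_d(G):g\notin M\}$, $g\in G$, and put $V_d(g)=\{M\in \mathrm{Max}_d(G):g\in M\}$. An element $e\ge 0$ of $G$ is complemented if there is $f\ge 0$ in $G$ such that $e\wedge f=0$ and $e\vee f$ is a weak order unit. Each $M\in\mathrm{Max}_d(G)$ is contained in exactly one value $\lambda_u(M)$ of $u$;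 the resulting map $\lambda_u:\mathrm{Max}_d(G)\to YG$ is continuous, and $\bigcap_{g\in M}\operatorname{cl}\operatorname{int}Z(g)=\{\lambda_u(M)\}$ for each $M$. For every complemented element $e$ of $G$ the set $V_d(e)$ is clopen and $$\lambda_u(V_d(e))=\operatorname{cl}\operatorname{int}Z(e).$$ -/

import Mathlib

namespace WObj

section Algebra

variable {G : Type*} [AddCommGroup G] [Lattice G] [IsOrderedAddMonoid G]

/-- The archimedean property of lattice-ordered groups: no nonzero positive element has all
its multiples below a fixed positive element (there are no nonzero infinitesimals). -/
def IsArchimedeanLGroup (G : Type*) [AddCommGroup G] [Lattice G] : Prop :=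
  ∀ a b : G, 0 ≤ a → 0 ≤ b → (∀ n : ℕ, n • a ≤ b) → a = 0

/-- The polar of a subset of `G`. -/
def polar (S : Set G) : Set G := {h | ∀ g ∈ S, |h| ⊓ |g| = 0}

/-- A weak order unit is an element whose polar is zero. -/
def IsWeakOrderUnit (g : G) : Prop := polar {g} = {0}

/-- Convex `ℓ`-subgroups: order-convex subgroups that are also sublattices. -/
structure IsConvexLSubgroup (H : AddSubgroup G) : Prop where
  sup_mem : ∀ a ∈ H, ∀ b ∈ H, a ⊔ b ∈ H
  inf_mem : ∀ a ∈ H, ∀ b ∈ H, a ⊓ b ∈ H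
  convex : ∀ a ∈ H, ∀ b ∈ H, ∀ x, a ≤ x → x ≤ b → x ∈ H

/-- A `d`-subgroup is a convex `ℓ`-subgroup that contains the double polar of each of
its elements. -/
def IsDSubgroup (H : AddSubgroup G) : Prop :=
  IsConvexLSubgroup H ∧ ∀ h ∈ H, polar (polar {h}) ⊆ (H : Set G)

/-- A positive element `e` is complemented if some positive `f` is disjoint from `e` and
`e ⊔ f` is a weak order unit. -/
def IsComplementedElt (e : G) : Prop :=
  0 ≤ e ∧ ∃ f : G, 0 ≤ f ∧ e ⊓ f = 0 ∧ IsWeakOrderUnit (e ⊔ f)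

/-- The values of `u`: the convex `ℓ`-subgroups maximal with respect to not containing `u`. -/
def IsValue (u : G) (V : AddSubgroup G) : Prop :=
  Maximal (fun H : AddSubgroup G => IsConvexLSubgroup H ∧ u ∉ H) V

end Algebra

section Spaces

variable {G : Type*} [AddCommGroup G] [Lattice G] [IsOrderedAddMonoid G]

/-- The Yosida space of `(G, u)`: the set of values of `u`. -/
def YosidaSpace (u : G) : Type _ := {V : AddSubgroup G // IsValue u V}

/-- The cozero-set of `g` in the Yosida space. -/
def cozeroSet (u g : G) : Set (YosidaSpace u) := {V | g ∉ V.1}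

/-- The zero-set of `g` in the Yosida space. -/
def zeroSet (u g : G) : Set (YosidaSpace u) := {V | g ∈ V.1}

/-- The hull-kernel topology on the Yosida space. -/
instance (u : G) : TopologicalSpace (YosidaSpace u) :=
  TopologicalSpace.generateFrom (Set.range (cozeroSet u))

variable (G) in
/-- The set of maximal `d`-subgroups: maximal among the proper `d`-subgroups. -/
def MaxD : Type _ :=
  {M : AddSubgroup G // Maximal (fun H : AddSubgroup G => IsDSubgroup H ∧ H ≠ ⊤) M}

/-- `U_d(g)`: the maximal `d`-subgroups that do not contain `g`. -/
def Ud (g : G) : Set (MaxD G) := {M | g ∉ M.1}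

/-- `V_d(g)`: the maximal `d`-subgroups that contain `g`. -/
def Vd (g : G) : Set (MaxD G) := {M | g ∈ M.1}

/-- The hull-kernel topology on the space of maximal `d`-subgroups. -/
instance : TopologicalSpace (MaxD G) :=
  TopologicalSpace.generateFrom (Set.range (Ud (G := G)))

/-- A proper `d`-subgroup contains no weak order unit. -/
theorem IsDSubgroup.weakUnit_notMem {H : AddSubgroup G} (hH : IsDSubgroup H) (hne : H ≠ ⊤)
    {u : G} (hu : IsWeakOrderUnit u) : u ∉ H := by
  intro huH
  apply hne
  rw [eq_top_iff]
  intro x _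
  apply hH.2 u huH
  intro g hg
  rw [show polar {u} = {0} from hu] at hg
  rw [Set.mem_singleton_iff.mp hg, abs_zero]
  exact inf_eq_right.mpr (abs_nonneg x)

/-- A convex `ℓ`-subgroup that does not contain `u` extends to a value of `u`. -/
theorem exists_value_ge {u : G} {H : AddSubgroup G} (hH : IsConvexLSubgroup H) (hu : u ∉ H) :
    ∃ V : YosidaSpace u, H ≤ V.1 := by
  obtain ⟨V, hle, hV⟩ := zorn_le_nonempty₀ {K : AddSubgroup G | IsConvexLSubgroup K ∧ u ∉ K}
    (fun c hc hchain y hy => by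
      have hdir : DirectedOn (· ≤ ·) c := hchain.directedOn
      have hne : c.Nonempty := ⟨y, hy⟩
      have key : ∀ x, x ∈ sSup c ↔ ∃ K ∈ c, x ∈ K := fun x =>
        AddSubgroup.mem_sSup_of_directedOn hne hdir
      have pair : ∀ a ∈ sSup c, ∀ b ∈ sSup c, ∃ K ∈ c, a ∈ K ∧ b ∈ K := by
        intro a ha b hb
        obtain ⟨K, hK, haK⟩ := (key a).1 ha
        obtain ⟨L, hL, hbL⟩ := (key b).1 hb
        obtain ⟨N, hN, hKN, hLN⟩ := hdir K hK L hL
        exact ⟨N, hN, hKN haK, hLN hbL⟩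
      refine ⟨sSup c, ⟨⟨?_, ?_, ?_⟩, ?_⟩, fun K hK => le_sSup hK⟩
      · intro a ha b hb
        obtain ⟨K, hK, h1, h2⟩ := pair a ha b hb
        exact (key _).2 ⟨K, hK, (hc hK).1.sup_mem a h1 b h2⟩
      · intro a ha b hb
        obtain ⟨K, hK, h1, h2⟩ := pair a ha b hb
        exact (key _).2 ⟨K, hK, (hc hK).1.inf_mem a h1 b h2⟩
      · intro a ha b hb x hax hxb
        obtain ⟨K, hK, h1, h2⟩ := pair a ha b hb
        exact (key _).2 ⟨K, hK, (hc hK).1.convex a h1 b h2 x hax hxb⟩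
      · intro h
        obtain ⟨K, hK, h1⟩ := (key u).1 h
        exact (hc hK).2 h1) H ⟨hH, hu⟩
  exact ⟨⟨V, hV⟩, hle⟩

/-- Every maximal `d`-subgroup extends to a value of the weak order unit `u`. -/
theorem MaxD.exists_value {u : G} (hu : IsWeakOrderUnit u) (M : MaxD G) :
    ∃ V : YosidaSpace u, M.1 ≤ V.1 :=
  exists_value_ge M.2.prop.1.1 (M.2.prop.1.weakUnit_notMem M.2.prop.2 hu)

/-- The canonical map `λ_u`, which sends a maximal `d`-subgroup `M` to the value of `u`
containing `M` (when `G` is archimedean and `0 ≤ u`, there is exactly one such value). -/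
noncomputable def lambdaMap {u : G} (hu : IsWeakOrderUnit u) (M : MaxD G) : YosidaSpace u :=
  Classical.choose (M.exists_value hu)

end Spaces

end WObj

set_option linter.unusedSectionVars false

/-! Values and maximal `d`-subgroups are both prime. Convex `ℓ`-subgroups above a prime form a chain
and distinct values are incomparable, so each `M` lies in just one value. The archimedean hypothesis
makes the values intersect in zero, so a nonempty cozero-set is the same as a nonzero element. Hence
`V ∈ cl int Z(g)` becomes algebraic: it says `g^⊥⊥ ⊆ V` (`mem_closure_interior_zeroSet_iff`). For `g
∈ M` this follows from `g^⊥⊥ ⊆ M ⊆ λ_u(M)`. Conversely, if `e^⊥⊥ ⊆ W`, the germ subgroup of `W` and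
`e` generate a proper `d`-subgroup. A maximal `d`-subgroup above it contains `e`, and the germ
forces its value to be `W`. Complementation serves to make `V_d(e)` open. -/

namespace WObj

/-! ### Disjointness and polars. -/

section Disjointness

variable {G : Type*} [AddCommGroup G] [Lattice G] [IsOrderedAddMonoid G]

theorem inf_add_eq_zero {a b c : G} (hb : a ⊓ b = 0) (hc : a ⊓ c = 0) : a ⊓ (b + c) = 0 := by
  have ha0 : 0 ≤ a := hb ▸ inf_le_left
  have hb0 : 0 ≤ b := hb ▸ inf_le_right
  have hc0 : 0 ≤ c := hc ▸ inf_le_right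
  refine le_antisymm ?_ (le_inf ha0 (add_nonneg hb0 hc0))
  have h1 : a ⊓ (b + c) ≤ (a + c) ⊓ (b + c) := inf_le_inf_right _ (le_add_of_nonneg_right hc0)
  rw [← inf_add, hb, zero_add] at h1
  exact hc ▸ le_inf inf_le_left h1

theorem inf_nsmul_eq_zero {a b : G} (h : a ⊓ b = 0) (n : ℕ) : a ⊓ n • b = 0 := by
  induction n with
  | zero => rw [zero_nsmul]; exact inf_eq_right.2 (h ▸ inf_le_left)
  | succ n ih => rw [succ_nsmul]; exact inf_add_eq_zero ih h

theorem inf_eq_zero_of_le {a b c : G} (ha : 0 ≤ a) (hb : 0 ≤ b) (hbc : b ≤ c) (h : a ⊓ c = 0) :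
    a ⊓ b = 0 :=
  le_antisymm (h ▸ inf_le_inf_left _ hbc) (le_inf ha hb)

theorem abs_inf_abs_eq_zero_of_le {x y z : G} (hyz : |y| ≤ |z|) (h : |x| ⊓ |z| = 0) :
    |x| ⊓ |y| = 0 :=
  inf_eq_zero_of_le (abs_nonneg _) (abs_nonneg _) hyz h

theorem mem_polar_singleton {x g : G} : x ∈ polar {g} ↔ |x| ⊓ |g| = 0 := by
  simp [polar]

theorem isWeakOrderUnit_iff {w : G} : IsWeakOrderUnit w ↔ ∀ x : G, |x| ⊓ |w| = 0 → x = 0 := by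
  constructor
  · intro h x hx
    have : x ∈ polar {w} := mem_polar_singleton.2 hx
    rwa [show polar {w} = {0} from h] at this
  · intro h
    refine Set.Subset.antisymm (fun x hx => h x (mem_polar_singleton.1 hx)) ?_
    rintro _ rfl
    rw [mem_polar_singleton, abs_zero]
    exact inf_eq_left.2 (abs_nonneg _)

theorem mem_polar_of_abs_le {S : Set G} {x y : G} (hy : y ∈ polar S) (h : |x| ≤ |y|) :
    x ∈ polar S := fun g hg => by
  rw [inf_comm]
  exact abs_inf_abs_eq_zero_of_le h (by rw [inf_comm]; exact hy g hg)

theorem add_mem_polar {S : Set G} {x y : G} (hx : x ∈ polar S) (hy : y ∈ polar S) :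
    x + y ∈ polar S := fun g hg => by
  have h : |g| ⊓ (|x| + |y|) = 0 :=
    inf_add_eq_zero (by rw [inf_comm]; exact hx g hg) (by rw [inf_comm]; exact hy g hg)
  rw [inf_comm]
  exact inf_eq_zero_of_le (abs_nonneg _) (abs_nonneg _) (abs_add_le x y) h

theorem mem_polar_polar_self (g : G) : g ∈ polar (polar {g}) := fun k hk => by
  rw [inf_comm]
  exact mem_polar_singleton.1 hk

theorem polar_polar_subset {S : Set G} {x : G} (hx : x ∈ polar (polar S)) :
    polar (polar {x}) ⊆ polar (polar S) := fun y hy g hg =>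
  hy g (mem_polar_singleton.2 (by rw [inf_comm]; exact hx g hg))

theorem polar_polar_subset_of_abs_le {g h : G} (hgh : |g| ≤ |h|) :
    polar (polar {g}) ⊆ polar (polar {h}) :=
  polar_polar_subset (mem_polar_of_abs_le (mem_polar_polar_self h) hgh)

end Disjointness

/-! ### Generated convex `ℓ`-subgroups and `d`-subgroups. -/

section ConvexSubgroups

variable {G : Type*} [AddCommGroup G] [Lattice G] [IsOrderedAddMonoid G]

theorem IsConvexLSubgroup.abs_mem {H : AddSubgroup G} (hH : IsConvexLSubgroup H) {x : G}
    (hx : x ∈ H) : |x| ∈ H :=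
  hH.sup_mem x hx (-x) (H.neg_mem hx)

theorem IsConvexLSubgroup.mem_of_abs_le {H : AddSubgroup G} (hH : IsConvexLSubgroup H) {x y : G}
    (hy : y ∈ H) (h : |x| ≤ |y|) : x ∈ H :=
  hH.convex (-|y|) (H.neg_mem (hH.abs_mem hy)) |y| (hH.abs_mem hy) x
    (neg_le.1 ((neg_le_abs x).trans h)) ((le_abs_self x).trans h)

theorem IsConvexLSubgroup.mem_of_le {H : AddSubgroup G} (hH : IsConvexLSubgroup H) {x y : G}
    (hy : y ∈ H) (hx : 0 ≤ x) (h : x ≤ y) : x ∈ H :=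
  hH.convex 0 H.zero_mem y hy x hx h

theorem isConvexLSubgroup_of_abs_le {H : AddSubgroup G}
    (hH : ∀ x y : G, y ∈ H → |x| ≤ |y| → x ∈ H) : IsConvexLSubgroup H := by
  have habs : ∀ x ∈ H, |x| ∈ H := fun x hx => hH _ x hx (abs_abs x).le
  have hsq : ∀ a ∈ H, ∀ b ∈ H, ∀ x, -(|a| + |b|) ≤ x → x ≤ |a| + |b| → x ∈ H := by
    intro a ha b hb x h1 h2
    refine hH x (|a| + |b|) (H.add_mem (habs a ha) (habs b hb)) ?_
    rw [abs_of_nonneg (add_nonneg (abs_nonneg a) (abs_nonneg b))]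
    exact abs_le'.2 ⟨h2, neg_le.1 h1⟩
  have hub : ∀ a b : G, a ≤ |a| + |b| ∧ b ≤ |a| + |b| ∧ -(|a| + |b|) ≤ a ∧ -(|a| + |b|) ≤ b :=
    fun a b =>
      ⟨(le_abs_self a).trans (le_add_of_nonneg_right (abs_nonneg b)),
        (le_abs_self b).trans (le_add_of_nonneg_left (abs_nonneg a)),
        neg_le.1 ((neg_le_abs a).trans (le_add_of_nonneg_right (abs_nonneg b))),
        neg_le.1 ((neg_le_abs b).trans (le_add_of_nonneg_left (abs_nonneg a)))⟩
  refine ⟨fun a ha b hb => ?_, fun a ha b hb => ?_, fun a ha b hb x h1 h2 => ?_⟩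
  · obtain ⟨h1, h2, h3, -⟩ := hub a b
    exact hsq a ha b hb _ (h3.trans le_sup_left) (sup_le h1 h2)
  · obtain ⟨h1, -, h3, h4⟩ := hub a b
    exact hsq a ha b hb _ (le_inf h3 h4) (inf_le_left.trans h1)
  · obtain ⟨-, h4, h3, -⟩ := hub a b
    exact hsq a ha b hb _ (h3.trans h1) (h2.trans h4)

/-- The convex `ℓ`-subgroup generated by a convex `ℓ`-subgroup `H` and an element `a`. -/
def adjoin (H : AddSubgroup G) (hH : IsConvexLSubgroup H) (a : G) : AddSubgroup G where
  carrier := {x | ∃ h ∈ H, ∃ n : ℕ, |x| ≤ |h| + n • |a|}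
  zero_mem' := ⟨0, H.zero_mem, 0, by simp⟩
  add_mem' := by
    rintro x y ⟨h, hh, n, hx⟩ ⟨k, hk, m, hy⟩
    refine ⟨|h| + |k|, H.add_mem (hH.abs_mem hh) (hH.abs_mem hk), n + m, ?_⟩
    rw [abs_of_nonneg (add_nonneg (abs_nonneg h) (abs_nonneg k)), add_nsmul,
      add_add_add_comm]
    exact (abs_add_le x y).trans (add_le_add hx hy)
  neg_mem' := by
    rintro x ⟨h, hh, n, hx⟩
    exact ⟨h, hh, n, by rwa [abs_neg]⟩

theorem isConvexLSubgroup_adjoin {H : AddSubgroup G} (hH : IsConvexLSubgroup H) (a : G) :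
    IsConvexLSubgroup (adjoin H hH a) :=
  isConvexLSubgroup_of_abs_le fun _ _ ⟨h, hh, n, hy⟩ hxy => ⟨h, hh, n, hxy.trans hy⟩

theorem le_adjoin {H : AddSubgroup G} (hH : IsConvexLSubgroup H) (a : G) : H ≤ adjoin H hH a :=
  fun x hx => ⟨x, hx, 0, by simp⟩

theorem mem_adjoin_self {H : AddSubgroup G} (hH : IsConvexLSubgroup H) (a : G) :
    a ∈ adjoin H hH a :=
  ⟨0, H.zero_mem, 1, by simp⟩

/-- The `d`-subgroup generated by a convex `ℓ`-subgroup. -/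
def dHull (H : AddSubgroup G) (hH : IsConvexLSubgroup H) : AddSubgroup G where
  carrier := {x | ∃ h ∈ H, x ∈ polar (polar {h})}
  zero_mem' := ⟨0, H.zero_mem, mem_polar_polar_self 0⟩
  add_mem' := by
    rintro x y ⟨h, hh, hx⟩ ⟨k, hk, hy⟩
    have hs := abs_of_nonneg (add_nonneg (abs_nonneg h) (abs_nonneg k))
    refine ⟨|h| + |k|, H.add_mem (hH.abs_mem hh) (hH.abs_mem hk), add_mem_polar
      (polar_polar_subset_of_abs_le ?_ hx) (polar_polar_subset_of_abs_le ?_ hy)⟩ <;> rw [hs]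
    · exact le_add_of_nonneg_right (abs_nonneg k)
    · exact le_add_of_nonneg_left (abs_nonneg h)
  neg_mem' := by
    rintro x ⟨h, hh, hx⟩
    exact ⟨h, hh, mem_polar_of_abs_le hx (abs_neg x).le⟩

theorem isDSubgroup_dHull {H : AddSubgroup G} (hH : IsConvexLSubgroup H) :
    IsDSubgroup (dHull H hH) :=
  ⟨isConvexLSubgroup_of_abs_le fun _ _ ⟨h, hh, hy⟩ hxy => ⟨h, hh, mem_polar_of_abs_le hy hxy⟩,
    fun _ ⟨h, hh, hx⟩ _ hy => ⟨h, hh, polar_polar_subset hx hy⟩⟩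

theorem le_dHull {H : AddSubgroup G} (hH : IsConvexLSubgroup H) : H ≤ dHull H hH :=
  fun x hx => ⟨x, hx, mem_polar_polar_self x⟩

/-- If `u ∈ w^⊥⊥`, then whatever is disjoint from `w` is disjoint from `u`, hence zero. This is the
properness test for generated `d`-subgroups. -/
theorem exists_isWeakOrderUnit_of_dHull_eq_top {H : AddSubgroup G} (hH : IsConvexLSubgroup H)
    {u : G} (hu : IsWeakOrderUnit u) (h : dHull H hH = ⊤) : ∃ w ∈ H, IsWeakOrderUnit w := by
  have huH : u ∈ dHull H hH := h ▸ AddSubgroup.mem_top u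
  obtain ⟨w, hw, huw⟩ := huH
  refine ⟨w, hw, isWeakOrderUnit_iff.2 fun x hx => isWeakOrderUnit_iff.1 hu x ?_⟩
  rw [inf_comm]
  exact huw x (mem_polar_singleton.2 hx)

end ConvexSubgroups

/-! ### Prime subgroups and their germs. -/

section Primes

variable {G : Type*} [AddCommGroup G] [Lattice G] [IsOrderedAddMonoid G]

theorem sub_inf_inf_sub_inf (a b : G) : (a - a ⊓ b) ⊓ (b - a ⊓ b) = 0 := by
  rw [← inf_sub, sub_self]

/-- Prime convex `ℓ`-subgroups. -/
structure IsPrimeLSubgroup (P : AddSubgroup G) : Prop where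
  isConvex : IsConvexLSubgroup P
  mem_or_mem : ∀ a b : G, a ⊓ b = 0 → a ∈ P ∨ b ∈ P

theorem IsPrimeLSubgroup.mem_or_mem_of_inf_mem {P : AddSubgroup G} (hP : IsPrimeLSubgroup P)
    {a b : G} (h : a ⊓ b ∈ P) : a ∈ P ∨ b ∈ P := by
  refine (hP.mem_or_mem _ _ (sub_inf_inf_sub_inf a b)).imp (fun h1 => ?_) (fun h1 => ?_)
  · simpa using P.add_mem h1 h
  · simpa using P.add_mem h1 h

theorem IsPrimeLSubgroup.mem_of_abs_inf_abs_eq_zero {P : AddSubgroup G} (hP : IsPrimeLSubgroup P)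
    {a b : G} (h : |a| ⊓ |b| = 0) (hb : b ∉ P) : a ∈ P := by
  rcases hP.mem_or_mem _ _ h with h1 | h1
  · exact hP.isConvex.mem_of_abs_le h1 (abs_abs a).ge
  · exact absurd (hP.isConvex.mem_of_abs_le h1 (abs_abs b).ge) hb

theorem exists_inf_eq_zero_of_not_le {V W : AddSubgroup G} (hV : IsConvexLSubgroup V)
    (hW : IsConvexLSubgroup W) (h1 : ¬ V ≤ W) (h2 : ¬ W ≤ V) :
    ∃ a b : G, a ⊓ b = 0 ∧ a ∉ W ∧ b ∉ V := by
  obtain ⟨x, hxV, hxW⟩ := SetLike.not_le_iff_exists.1 h1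
  obtain ⟨y, hyW, hyV⟩ := SetLike.not_le_iff_exists.1 h2
  have h0 : 0 ≤ |x| ⊓ |y| := le_inf (abs_nonneg x) (abs_nonneg y)
  refine ⟨_, _, sub_inf_inf_sub_inf |x| |y|, fun h => hxW ?_, fun h => hyV ?_⟩
  · have := W.add_mem h (hW.mem_of_le (hW.abs_mem hyW) h0 inf_le_right)
    rw [sub_add_cancel] at this
    exact hW.mem_of_abs_le this (abs_abs x).ge
  · have := V.add_mem h (hV.mem_of_le (hV.abs_mem hxV) h0 inf_le_left)
    rw [sub_add_cancel] at this
    exact hV.mem_of_abs_le this (abs_abs y).ge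

theorem IsPrimeLSubgroup.le_or_le {P V W : AddSubgroup G} (hP : IsPrimeLSubgroup P)
    (hV : IsConvexLSubgroup V) (hW : IsConvexLSubgroup W) (hPV : P ≤ V) (hPW : P ≤ W) :
    V ≤ W ∨ W ≤ V := by
  by_contra! h
  obtain ⟨a, b, hab, ha, hb⟩ := exists_inf_eq_zero_of_not_le hV hW h.1 h.2
  exact (hP.mem_or_mem a b hab).elim (fun h => ha (hPW h)) (fun h => hb (hPV h))

/-- The elements disjoint from some element outside a proper prime subgroup `P`. -/
def germ (P : AddSubgroup G) (hP : IsPrimeLSubgroup P) (hne : ∃ k, k ∉ P) : AddSubgroup G where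
  carrier := {x | ∃ k, k ∉ P ∧ |x| ⊓ |k| = 0}
  zero_mem' := by
    obtain ⟨k, hk⟩ := hne
    exact ⟨k, hk, by rw [abs_zero]; exact inf_eq_left.2 (abs_nonneg _)⟩
  add_mem' := by
    rintro x y ⟨k, hk, hx⟩ ⟨l, hl, hy⟩
    have h0 : 0 ≤ |k| ⊓ |l| := le_inf (abs_nonneg k) (abs_nonneg l)
    -- Primeness keeps the meet of two elements outside `P` outside `P`.
    refine ⟨|k| ⊓ |l|, fun h => ?_, ?_⟩
    · rcases hP.mem_or_mem_of_inf_mem h with h1 | h1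
      · exact hk (hP.isConvex.mem_of_abs_le h1 (abs_abs k).ge)
      · exact hl (hP.isConvex.mem_of_abs_le h1 (abs_abs l).ge)
    · have h1 : (|k| ⊓ |l|) ⊓ (|x| + |y|) = 0 := by
        refine inf_add_eq_zero ?_ ?_ <;> rw [inf_comm]
        · exact inf_eq_zero_of_le (abs_nonneg x) h0 inf_le_left hx
        · exact inf_eq_zero_of_le (abs_nonneg y) h0 inf_le_right hy
      rw [abs_of_nonneg h0, inf_comm]
      exact inf_eq_zero_of_le h0 (abs_nonneg _) (abs_add_le x y) h1
  neg_mem' := by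
    rintro x ⟨k, hk, hx⟩
    exact ⟨k, hk, by rwa [abs_neg]⟩

theorem isConvexLSubgroup_germ {P : AddSubgroup G} (hP : IsPrimeLSubgroup P)
    (hne : ∃ k, k ∉ P) : IsConvexLSubgroup (germ P hP hne) :=
  isConvexLSubgroup_of_abs_le fun x y ⟨k, hk, hy⟩ hxy => ⟨k, hk, by
    rw [inf_comm] at hy ⊢
    exact abs_inf_abs_eq_zero_of_le hxy hy⟩

end Primes

/-! ### Values of `u` and the Yosida space. -/

section Values

variable {G : Type*} [AddCommGroup G] [Lattice G] [IsOrderedAddMonoid G] {u : G}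

theorem IsValue.abs_le_add_nsmul {V : AddSubgroup G} (hV : IsValue u V) {a : G} (ha : a ∉ V) :
    ∃ v ∈ V, ∃ n : ℕ, |u| ≤ |v| + n • |a| := by
  by_contra hu
  have hc := hV.prop.1
  exact ha (hV.le_of_ge ⟨isConvexLSubgroup_adjoin hc a, hu⟩ (le_adjoin hc a)
    (mem_adjoin_self hc a))

theorem IsValue.isPrime {V : AddSubgroup G} (hV : IsValue u V) : IsPrimeLSubgroup V := by
  have hc := hV.prop.1
  refine ⟨hc, fun a b hab => ?_⟩
  by_contra! h
  obtain ⟨v, hv, n, hn⟩ := hV.abs_le_add_nsmul h.1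
  obtain ⟨w, hw, m, hm⟩ := hV.abs_le_add_nsmul h.2
  have ha0 : 0 ≤ a := hab ▸ inf_le_left
  have hb0 : 0 ≤ b := hab ▸ inf_le_right
  rw [abs_of_nonneg ha0] at hn
  rw [abs_of_nonneg hb0] at hm
  have hd : n • a ⊓ m • b = 0 := by
    rw [inf_comm]
    refine inf_nsmul_eq_zero ?_ n
    rw [inf_comm]
    exact inf_nsmul_eq_zero hab m
  -- The two bounds on `|u|` combine into a meet that vanishes, which traps `|u|` below an element
  -- of `V`.
  have h1 : |u| - (|v| + |w|) ≤ n • a ⊓ m • b := by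
    refine le_inf ?_ ?_ <;> rw [sub_le_iff_le_add']
    · exact hn.trans (add_le_add_left (le_add_of_nonneg_right (abs_nonneg w)) _)
    · exact hm.trans (add_le_add_left (le_add_of_nonneg_left (abs_nonneg v)) _)
  rw [hd, sub_nonpos] at h1
  have h2 := hc.mem_of_le (V.add_mem (hc.abs_mem hv) (hc.abs_mem hw)) (abs_nonneg u) h1
  exact hV.prop.2 (hc.mem_of_abs_le h2 (abs_abs u).ge)

theorem YosidaSpace.eq_of_le {V W : YosidaSpace u} (h : V.1 ≤ W.1) : V = W :=
  Subtype.ext (V.2.eq_of_le W.2.prop h)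

theorem YosidaSpace.isPrime (V : YosidaSpace u) : IsPrimeLSubgroup V.1 := V.2.isPrime

theorem YosidaSpace.isConvex (V : YosidaSpace u) : IsConvexLSubgroup V.1 := V.2.prop.1

theorem IsPrimeLSubgroup.value_unique {P : AddSubgroup G} (hP : IsPrimeLSubgroup P)
    {V W : YosidaSpace u} (hV : P ≤ V.1) (hW : P ≤ W.1) : V = W :=
  (hP.le_or_le V.isConvex W.isConvex hV hW).elim YosidaSpace.eq_of_le
    fun h => (YosidaSpace.eq_of_le h).symm

/-- In an archimedean group the values of a weak order unit intersect in zero. -/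
theorem eq_zero_of_forall_value_mem (hG : IsArchimedeanLGroup G) (hu₀ : 0 ≤ u)
    (hu : IsWeakOrderUnit u) {g : G} (hg : ∀ V : YosidaSpace u, g ∈ V.1) : g = 0 := by
  have hwu : ∀ w : G, 0 ≤ w → w ⊓ u = 0 → w = 0 := fun w hw h =>
    isWeakOrderUnit_iff.1 hu w (by rwa [abs_of_nonneg hw, abs_of_nonneg hu₀])
  have hk0 : 0 ≤ |g| ⊓ u := le_inf (abs_nonneg g) hu₀
  suffices h : |g| ⊓ u = 0 from isWeakOrderUnit_iff.1 hu g (by rwa [abs_of_nonneg hu₀])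
  refine hG _ u hk0 hu₀ fun n => ?_
  set k := |g| ⊓ u with hk
  by_contra hn
  have hw : (n • k - u)⁺ ⊓ u ≠ 0 := fun h => by
    have := hwu _ (posPart_nonneg _) h
    rw [posPart_eq_zero, sub_nonpos] at this
    exact hn this
  have hbot : IsConvexLSubgroup (⊥ : AddSubgroup G) :=
    isConvexLSubgroup_of_abs_le fun x y hy hxy => by
      rw [AddSubgroup.mem_bot] at hy ⊢
      subst hy
      rw [abs_zero] at hxy
      exact le_antisymm ((le_abs_self x).trans hxy) (neg_nonpos.1 ((neg_le_abs x).trans hxy))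
  -- A value `P` of this nonzero element omits `(n • k - u)⁺` and `u`, so it contains `(n • k -
  -- u)⁻`. In a value of `u` above `P`, `u ≤ n • k + (n • k - u)⁻` gives a contradiction.
  obtain ⟨P, -⟩ := exists_value_ge hbot (u := (n • k - u)⁺ ⊓ u)
    (fun h => hw (AddSubgroup.mem_bot.1 h))
  have hw0 : 0 ≤ (n • k - u)⁺ ⊓ u := le_inf (posPart_nonneg _) hu₀
  have huP : u ∉ P.1 := fun h => P.2.prop.2 (P.isConvex.mem_of_le h hw0 inf_le_right)
  obtain ⟨V, hPV⟩ := exists_value_ge P.isConvex huP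
  have hneg : (n • k - u)⁻ ∈ V.1 := hPV <|
    (P.isPrime.mem_or_mem _ _ (posPart_inf_negPart_eq_zero _)).resolve_left
      fun h => P.2.prop.2 (P.isConvex.mem_of_le h hw0 inf_le_left)
  have hkV : k ∈ V.1 := V.isConvex.mem_of_le (V.isConvex.abs_mem (hg V)) hk0 inf_le_left
  refine V.2.prop.2 (V.isConvex.mem_of_le
    (V.1.add_mem (V.1.nsmul_mem hkV n) hneg) hu₀ ?_)
  have := neg_le_negPart (n • k - u)
  rwa [neg_sub, sub_le_iff_le_add'] at this

theorem cozeroSet_inter (f g : G) : cozeroSet u f ∩ cozeroSet u g = cozeroSet u (|f| ⊓ |g|) := by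
  ext V
  constructor
  · rintro ⟨hf, hg⟩ h
    rcases V.isPrime.mem_or_mem_of_inf_mem h with h1 | h1
    · exact hf (V.isConvex.mem_of_abs_le h1 (abs_abs f).ge)
    · exact hg (V.isConvex.mem_of_abs_le h1 (abs_abs g).ge)
  · intro h
    have h0 : 0 ≤ |f| ⊓ |g| := le_inf (abs_nonneg f) (abs_nonneg g)
    exact ⟨fun hf => h (V.isConvex.mem_of_le (V.isConvex.abs_mem hf) h0 inf_le_left),
      fun hg => h (V.isConvex.mem_of_le (V.isConvex.abs_mem hg) h0 inf_le_right)⟩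

theorem isOpen_cozeroSet (g : G) : IsOpen (cozeroSet u g) :=
  TopologicalSpace.isOpen_generateFrom_of_mem ⟨g, rfl⟩

theorem isTopologicalBasis_cozeroSet :
    TopologicalSpace.IsTopologicalBasis (Set.range (cozeroSet u)) where
  exists_subset_inter := by
    rintro _ ⟨f, rfl⟩ _ ⟨g, rfl⟩ V hV
    rw [cozeroSet_inter] at hV ⊢
    exact ⟨_, ⟨_, rfl⟩, hV, subset_rfl⟩
  sUnion_eq := Set.eq_univ_of_forall fun V => ⟨cozeroSet u u, ⟨u, rfl⟩, V.2.prop.2⟩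
  eq_generateFrom := rfl

theorem mem_zeroSet_of_abs_inf_abs_eq_zero {V : YosidaSpace u} {f g : G} (h : |f| ⊓ |g| = 0)
    (hV : V ∈ cozeroSet u g) : V ∈ zeroSet u f :=
  V.isPrime.mem_of_abs_inf_abs_eq_zero h hV

theorem cozeroSet_nonempty (hG : IsArchimedeanLGroup G) (hu₀ : 0 ≤ u) (hu : IsWeakOrderUnit u)
    {g : G} (hg : g ≠ 0) : (cozeroSet u g).Nonempty := by
  by_contra h
  refine hg (eq_zero_of_forall_value_mem hG hu₀ hu fun V => ?_)
  by_contra hV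
  exact h ⟨V, hV⟩

/-- The closure of the interior of a zero-set, in terms of disjointness. -/
theorem mem_closure_interior_zeroSet_iff (hG : IsArchimedeanLGroup G) (hu₀ : 0 ≤ u)
    (hu : IsWeakOrderUnit u) {g : G} {V : YosidaSpace u} :
    V ∈ closure (interior (zeroSet u g)) ↔
      ∀ f, f ∉ V.1 → ∃ h, |h| ⊓ |g| = 0 ∧ |h| ⊓ |f| ≠ 0 := by
  rw [isTopologicalBasis_cozeroSet.mem_closure_iff]
  constructor
  · intro H f hf
    obtain ⟨W, hWf, hWg⟩ := H _ ⟨f, rfl⟩ hf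
    obtain ⟨_, ⟨h, rfl⟩, hWh, hsub⟩ :=
      isTopologicalBasis_cozeroSet.exists_subset_of_mem_open hWg isOpen_interior
    refine ⟨h, ?_, fun h0 => hWh (W.isPrime.mem_of_abs_inf_abs_eq_zero h0 hWf)⟩
    refine eq_zero_of_forall_value_mem hG hu₀ hu fun U => ?_
    by_contra hU
    have hU' : U ∈ cozeroSet u (|h| ⊓ |g|) := hU
    rw [← cozeroSet_inter] at hU'
    exact hU'.2 (interior_subset (s := zeroSet u g) (hsub hU'.1))
  · rintro H _ ⟨f, rfl⟩ hf
    obtain ⟨h, hg, hf⟩ := H f hf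
    obtain ⟨W, hW⟩ := cozeroSet_nonempty hG hu₀ hu hf
    rw [← cozeroSet_inter] at hW
    refine ⟨W, hW.2, mem_interior.2 ⟨cozeroSet u h, fun U hU => ?_, isOpen_cozeroSet h, hW.1⟩⟩
    exact mem_zeroSet_of_abs_inf_abs_eq_zero (by rwa [inf_comm]) hU

end Values

/-! ### Maximal `d`-subgroups and the map `λ_u`. -/

section MaximalDSubgroups

variable {G : Type*} [AddCommGroup G] [Lattice G] [IsOrderedAddMonoid G] {u : G}

theorem exists_maxD_ge (hu : IsWeakOrderUnit u) {H : AddSubgroup G} (hH : IsDSubgroup H)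
    (hne : H ≠ ⊤) : ∃ M : MaxD G, H ≤ M.1 := by
  -- Properness restated as omitting `u` survives unions of chains.
  have hiff : ∀ K : AddSubgroup G, IsDSubgroup K → (K ≠ ⊤ ↔ u ∉ K) := fun K hK =>
    ⟨fun h => hK.weakUnit_notMem h hu, fun h h' => h (h' ▸ AddSubgroup.mem_top u)⟩
  obtain ⟨M, hle, hM⟩ := zorn_le_nonempty₀ {K : AddSubgroup G | IsDSubgroup K ∧ K ≠ ⊤}
    (fun c hc hchain y hy => by
      have hdir : DirectedOn (· ≤ ·) c := hchain.directedOn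
      have key : ∀ x, x ∈ sSup c ↔ ∃ K ∈ c, x ∈ K := fun x =>
        AddSubgroup.mem_sSup_of_directedOn ⟨y, hy⟩ hdir
      have hd : IsDSubgroup (sSup c) := by
        refine ⟨isConvexLSubgroup_of_abs_le fun a b hb hab => ?_, fun h hh x hx => ?_⟩
        · obtain ⟨K, hK, h1⟩ := (key b).1 hb
          exact (key a).2 ⟨K, hK, (hc hK).1.1.mem_of_abs_le h1 hab⟩
        · obtain ⟨K, hK, h1⟩ := (key h).1 hh
          exact (key x).2 ⟨K, hK, (hc hK).1.2 h h1 hx⟩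
      refine ⟨sSup c, ⟨hd, (hiff _ hd).2 fun h => ?_⟩, fun K hK => le_sSup hK⟩
      obtain ⟨K, hK, h1⟩ := (key u).1 h
      exact (hiff K (hc hK).1).1 (hc hK).2 h1) H ⟨hH, hne⟩
  exact ⟨⟨M, hM⟩, hle⟩

theorem MaxD.isConvex (M : MaxD G) : IsConvexLSubgroup M.1 := M.2.prop.1.1

theorem MaxD.weakUnit_notMem (M : MaxD G) (hu : IsWeakOrderUnit u) : u ∉ M.1 :=
  M.2.prop.1.weakUnit_notMem M.2.prop.2 hu

/-- By maximality, `M` and `a` generate `G` as a `d`-subgroup, so some weak order unit is bounded by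
`|m| + n • |a|`. -/
theorem MaxD.exists_disjoint_eq_zero (hu : IsWeakOrderUnit u) (M : MaxD G) {a : G}
    (ha : a ∉ M.1) : ∃ m ∈ M.1, ∀ x : G, |x| ⊓ |m| = 0 → |x| ⊓ |a| = 0 → x = 0 := by
  have hc := isConvexLSubgroup_adjoin M.isConvex a
  have htop : dHull _ hc = ⊤ := by
    by_contra h
    exact ha (M.2.le_of_ge ⟨isDSubgroup_dHull hc, h⟩
      ((le_adjoin M.isConvex a).trans (le_dHull hc)) (le_dHull hc (mem_adjoin_self _ a)))
  obtain ⟨w, ⟨m, hm, n, hw⟩, hwu⟩ := exists_isWeakOrderUnit_of_dHull_eq_top hc hu htop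
  exact ⟨m, hm, fun x hxm hxa => isWeakOrderUnit_iff.1 hwu x <|
    inf_eq_zero_of_le (abs_nonneg _) (abs_nonneg _) hw
      (inf_add_eq_zero hxm (inf_nsmul_eq_zero hxa n))⟩

theorem MaxD.isPrime (hu : IsWeakOrderUnit u) (M : MaxD G) : IsPrimeLSubgroup M.1 := by
  refine ⟨M.isConvex, fun a b hab => ?_⟩
  by_contra! h
  have ha0 : 0 ≤ a := hab ▸ inf_le_left
  have hb0 : 0 ≤ b := hab ▸ inf_le_right
  obtain ⟨m, hm, hma⟩ := M.exists_disjoint_eq_zero hu h.1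
  obtain ⟨k, hk, hkb⟩ := M.exists_disjoint_eq_zero hu h.2
  have hs := abs_of_nonneg (add_nonneg (abs_nonneg m) (abs_nonneg k))
  refine M.weakUnit_notMem (u := |m| + |k|) (isWeakOrderUnit_iff.2 fun x hx => ?_)
    (M.1.add_mem (M.isConvex.abs_mem hm) (M.isConvex.abs_mem hk))
  have hxm : |x| ⊓ |m| = 0 :=
    abs_inf_abs_eq_zero_of_le (hs.symm ▸ le_add_of_nonneg_right (abs_nonneg k)) hx
  have hxk : |x| ⊓ |k| = 0 :=
    abs_inf_abs_eq_zero_of_le (hs.symm ▸ le_add_of_nonneg_left (abs_nonneg m)) hx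
  -- `|x| ⊓ |a|` is disjoint from `k` because `x` is, and from `b` because `a` is.
  refine hma x hxm ?_
  have h0 : 0 ≤ |x| ⊓ |a| := le_inf (abs_nonneg x) (abs_nonneg a)
  refine hkb _ ?_ ?_ <;> rw [abs_of_nonneg h0, inf_comm]
  · exact inf_eq_zero_of_le (abs_nonneg k) h0 inf_le_left (by rwa [inf_comm])
  · rw [abs_of_nonneg ha0, abs_of_nonneg hb0] at *
    exact inf_eq_zero_of_le hb0 h0 inf_le_right (by rwa [inf_comm])

theorem le_lambdaMap (hu : IsWeakOrderUnit u) (M : MaxD G) : M.1 ≤ (lambdaMap hu M).1 :=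
  Classical.choose_spec (M.exists_value hu)

theorem lambdaMap_eq_iff (hu : IsWeakOrderUnit u) {M : MaxD G} {V : YosidaSpace u} :
    lambdaMap hu M = V ↔ M.1 ≤ V.1 :=
  ⟨fun h => h ▸ le_lambdaMap hu M, fun h => (M.isPrime hu).value_unique (le_lambdaMap hu M) h⟩

theorem isOpen_Ud (g : G) : IsOpen (Ud g) :=
  TopologicalSpace.isOpen_generateFrom_of_mem ⟨g, rfl⟩

theorem isClosed_Vd (g : G) : IsClosed (Vd g) := by
  rw [← isOpen_compl_iff]
  exact isOpen_Ud g

theorem continuous_lambdaMap (hu₀ : 0 ≤ u) (hu : IsWeakOrderUnit u) :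
    Continuous (lambdaMap hu) := by
  refine continuous_generateFrom_iff.2 ?_
  rintro _ ⟨g, rfl⟩
  refine isOpen_iff_forall_mem_open.2 fun M hM => ?_
  set V := lambdaMap hu M with hV
  obtain ⟨v, hv, n, hn⟩ := V.2.abs_le_add_nsmul hM
  rw [abs_of_nonneg hu₀] at hn
  -- Doubling `u ≤ |v| + n • |g|` leaves a spare `u`: `u ≤ 2 • |v| + c`, so `c⁺ ∉ M`. A factor `n`
  -- would give only `0 ≤ |v| + c`.
  set c := (2 * n) • |g| - u with hc
  refine ⟨Ud c⁺, fun N hN hgN => ?_, isOpen_Ud _, fun hcM => ?_⟩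
  · have h1 : c⁻ ∈ (lambdaMap hu N).1 := le_lambdaMap hu N <|
      ((N.isPrime hu).mem_or_mem _ _ (posPart_inf_negPart_eq_zero c)).resolve_left hN
    have hcv := (lambdaMap hu N).isConvex
    refine (lambdaMap hu N).2.prop.2 (hcv.mem_of_le
      (AddSubgroup.add_mem _ (AddSubgroup.nsmul_mem _ (hcv.abs_mem hgN) (2 * n)) h1) hu₀ ?_)
    have := neg_le_negPart c
    rwa [hc, neg_sub, sub_le_iff_le_add'] at this
  · have h1 : c⁺ ∈ V.1 := le_lambdaMap hu M hcM
    have h2 : c ≤ c⁺ := le_posPart c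
    refine V.2.prop.2 (V.isConvex.mem_of_le
      (V.1.add_mem (V.1.nsmul_mem (V.isConvex.abs_mem hv) 2) h1) hu₀ ?_)
    have h3 : u + u ≤ (|v| + n • |g|) + (|v| + n • |g|) := add_le_add hn hn
    have h4 : u = (u + u) + c - (2 * n) • |g| := by rw [hc]; abel
    calc u = (u + u) + c - (2 * n) • |g| := h4
      _ ≤ ((|v| + n • |g|) + (|v| + n • |g|)) + c⁺ - (2 * n) • |g| :=
        sub_le_sub_right (add_le_add h3 h2) _
      _ = 2 • |v| + c⁺ := by rw [mul_nsmul, two_nsmul, two_nsmul, nsmul_add]; abel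

theorem lambdaMap_mem_closure_interior (hG : IsArchimedeanLGroup G) (hu₀ : 0 ≤ u)
    (hu : IsWeakOrderUnit u) (M : MaxD G) {g : G} (hg : g ∈ M.1) :
    lambdaMap hu M ∈ closure (interior (zeroSet u g)) := by
  rw [mem_closure_interior_zeroSet_iff hG hu₀ hu]
  intro f hf
  by_contra! H
  refine hf (le_lambdaMap hu M (M.2.prop.1.2 g hg fun h hh => ?_))
  rw [inf_comm]
  exact H h (mem_polar_singleton.1 hh)

theorem iInter_closure_interior_zeroSet (hG : IsArchimedeanLGroup G) (hu₀ : 0 ≤ u)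
    (hu : IsWeakOrderUnit u) (M : MaxD G) :
    ⋂ g ∈ M.1, closure (interior (zeroSet u g)) = {lambdaMap hu M} := by
  refine Set.Subset.antisymm (fun W hW => ?_) ?_
  · refine ((lambdaMap_eq_iff hu).2 fun g hg => ?_).symm
    by_contra hgW
    have hWg : W ∈ closure (interior (zeroSet u g)) := Set.mem_iInter₂.1 hW g hg
    obtain ⟨U, hU, hU'⟩ := mem_closure_iff.1 hWg _ (isOpen_cozeroSet g) hgW
    exact hU (interior_subset (s := zeroSet u g) hU')
  · rintro _ rfl
    exact Set.mem_iInter₂.2 fun g hg => lambdaMap_mem_closure_interior hG hu₀ hu M hg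

/-- Distinct values are separated by disjoint `a ∉ W` and `b ∉ V`; then `a` witnesses that `b` is in
the germ of `W`. -/
theorem YosidaSpace.eq_of_germ_le {V W : YosidaSpace u} (hne : ∃ k, k ∉ W.1)
    (h : germ W.1 W.isPrime hne ≤ V.1) : V = W := by
  by_contra hVW
  obtain ⟨a, b, hab, ha, hb⟩ := exists_inf_eq_zero_of_not_le V.isConvex W.isConvex
    (fun h => hVW (YosidaSpace.eq_of_le h)) (fun h => hVW (YosidaSpace.eq_of_le h).symm)
  refine hb (h ⟨a, ha, ?_⟩)
  rwa [abs_of_nonneg (hab ▸ inf_le_left : 0 ≤ a), abs_of_nonneg (hab ▸ inf_le_right : 0 ≤ b),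
    inf_comm]

/-- Every point of the closed interior of a zero-set comes from a maximal `d`-subgroup. -/
theorem closure_interior_zeroSet_subset_image (hG : IsArchimedeanLGroup G) (hu₀ : 0 ≤ u)
    (hu : IsWeakOrderUnit u) (e : G) :
    closure (interior (zeroSet u e)) ⊆ lambdaMap hu '' Vd e := by
  intro W hW
  rw [mem_closure_interior_zeroSet_iff hG hu₀ hu] at hW
  have hne : ∃ k, k ∉ W.1 := ⟨u, W.2.prop.2⟩
  have hgc := isConvexLSubgroup_germ W.isPrime hne
  have hac := isConvexLSubgroup_adjoin hgc e
  have hproper : dHull _ hac ≠ ⊤ := by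
    intro htop
    obtain ⟨w, ⟨m, ⟨k, hk, hmk⟩, n, hw⟩, hwu⟩ := exists_isWeakOrderUnit_of_dHull_eq_top hac hu htop
    -- `|h| ⊓ |k|` is nonzero yet disjoint from `m` (through `k`) and from `e` (through `h`), hence
    -- from `w`.
    obtain ⟨h, he, hne⟩ := hW k hk
    have h0 : 0 ≤ |h| ⊓ |k| := le_inf (abs_nonneg h) (abs_nonneg k)
    refine hne (isWeakOrderUnit_iff.1 hwu _ ?_)
    rw [abs_of_nonneg h0]
    refine inf_eq_zero_of_le h0 (abs_nonneg w) hw (inf_add_eq_zero ?_ (inf_nsmul_eq_zero ?_ n)) <;>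
      rw [inf_comm]
    · exact inf_eq_zero_of_le (abs_nonneg m) h0 inf_le_right hmk
    · exact inf_eq_zero_of_le (abs_nonneg e) h0 inf_le_left (by rwa [inf_comm])
  obtain ⟨M, hM⟩ := exists_maxD_ge hu (isDSubgroup_dHull hac) hproper
  have hM' := (le_dHull hac).trans hM
  exact ⟨M, hM' (mem_adjoin_self hgc e), YosidaSpace.eq_of_germ_le hne
    (((le_adjoin hgc e).trans hM').trans (le_lambdaMap hu M))⟩

theorem isClopen_Vd (hu : IsWeakOrderUnit u) {e : G} (he : IsComplementedElt e) :
    IsClopen (Vd e) := by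
  obtain ⟨-, f, -, hef, hw⟩ := he
  -- Primeness puts `e` or `f` in `M`; the weak order unit `e ⊔ f` forbids both.
  have : Vd e = Ud f := by
    ext M
    exact ⟨fun h1 h2 => M.weakUnit_notMem hw (M.isConvex.sup_mem e h1 f h2),
      fun h => ((M.isPrime hu).mem_or_mem e f hef).resolve_right h⟩
  exact ⟨isClosed_Vd e, this ▸ isOpen_Ud f⟩

end MaximalDSubgroups

end WObj

theorem mainTheorem3 {G : Type*} [AddCommGroup G] [Lattice G] [IsOrderedAddMonoid G]
    (hG : WObj.IsArchimedeanLGroup G) (u : G) (hu₀ : 0 ≤ u) (hu : WObj.IsWeakOrderUnit u) :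
    (∀ M : WObj.MaxD G, ∃! V : WObj.YosidaSpace u, M.1 ≤ V.1) ∧
    (∀ M : WObj.MaxD G, M.1 ≤ (WObj.lambdaMap hu M).1) ∧
    Continuous (WObj.lambdaMap hu) ∧
    (∀ M : WObj.MaxD G,
      ⋂ g ∈ M.1, closure (interior (WObj.zeroSet u g)) = {WObj.lambdaMap hu M}) ∧
    ∀ e : G, WObj.IsComplementedElt e →
      IsClopen (WObj.Vd e) ∧
      WObj.lambdaMap hu '' WObj.Vd e = closure (interior (WObj.zeroSet u e)) := by
  refine ⟨fun M => ⟨WObj.lambdaMap hu M, WObj.le_lambdaMap hu M, fun V hV =>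
      ((WObj.lambdaMap_eq_iff hu).2 hV).symm⟩, WObj.le_lambdaMap hu,
    WObj.continuous_lambdaMap hu₀ hu, WObj.iInter_closure_interior_zeroSet hG hu₀ hu,
    fun e he => ⟨WObj.isClopen_Vd hu he, Set.Subset.antisymm ?_
      (WObj.closure_interior_zeroSet_subset_image hG hu₀ hu e)⟩⟩
  rintro _ ⟨M, hM, rfl⟩
  exact WObj.lambdaMap_mem_closure_interior hG hu₀ hu M hM
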